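/- Let $\Gamma$ be a metrized graph, that is, a finite connected graph, possibly with multiple edges and self-loops, with vertex set $V(\Gamma)$ and edge set $E(\Gamma)$, in which every edge $e_i$ has a length $L_i>0$. Regard each edge as a resistor of resistance $L_i$. Let $j_z(x,y)$ be the voltage difference between $x$ and $z$ when unit current enters at $y$ and exits at $z$, let $r(x,y)=j_y(x,x)$ be the effective resistance, and let $Kf(\Gamma)=\frac12\sum_{p,q\in V(\Gamma)}r(p,q)$ be the Kirchhoff index. For an edge $e_i$ with end points $p_i,q_i$ and a vertex $p$, let $R_i$ be the effective resistance between $p_i$ and $q_i$ in $\Gamma-e_i$ (the graph with the interior of $e_i$ deleted), and let $R_{a_i,p}=\hat{\jmath}_{p_i}(p,q_i)$ and $R_{b_i,p}=\hat{\jmath}_{q_i}(p,p_i)$, where $\hat{\jmath}$ is the voltage function of $\Gamma-e_i$. If $e_i$ is a bridge, one sets $\{R_{a_i,p},R_{b_i,p}\}=\{0,R_i\}$ and lets $R_i\to\infty$ in every expression, so that $\frac{R_i}{L_i+R_i}$ means $1$, while $\frac{L_iR_i^2}{(L_i+R_i)^2}$ and $\frac{L_i(R_{a_i,p}-R_{b_i,p})^2}{(L_i+R_i)^2}$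 mean $L_i$. Put $$y(\Gamma)=\frac14\sum_{e_i\in E(\Gamma)}\frac{L_iR_i^2}{(L_i+R_i)^2}+\frac34\sum_{e_i\in E(\Gamma)}\frac{L_i(R_{a_i,p}-R_{b_i,p})^2}{(L_i+R_i)^2},$$ where $p$ is any fixed vertex of $\Gamma$. Let $\overline{\Gamma}_{i_1,\dots,i_k}$ be the graph obtained from $\Gamma$ by contracting $e_{i_1},\dots,e_{i_k}$ successively. The contraction is admissible if at each step the contracted edge has distinct end points in the graph in which it is contracted. Suppose that $\Gamma$ has $v\ge5$ vertices. Then for every integer $k$ with $1\le k\le v-4$, $$Kf(\Gamma)=\frac{(v-4-k)!}{(v-4)!}\sum_{e_{i_1}\in E(\Gamma)}\frac{R_{i_1}}{L_{i_1}+R_{i_1}}\sum_{e_{i_2}\in E(\overline{\Gamma}_{i_1})}\frac{R_{i_2}}{L_{i_2}+R_{i_2}}\cdots\sum_{e_{i_k}\in E(\overline{\Gamma}_{i_1,\dots,i_{k-1}})}\frac{R_{i_k}}{L_{i_k}+R_{i_k}}\,Kf(\overline{\Gamma}_{i_1,\dots,i_k})-\frac{\big(v^2-(k+2)v+k-1\big)k}{(v-k-2)(v-k-3)}\,y(\Gamma),$$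 where the sums run over admissible contractions and $R_{i_j}$ is computed in $\overline{\Gamma}_{i_1,\dots,i_{j-1}}$. In particular, for $k=v-4$, $$Kf(\Gamma)=\frac{1}{(v-4)!}\sum_{e_{i_1}\in E(\Gamma)}\frac{R_{i_1}}{L_{i_1}+R_{i_1}}\cdots\sum_{e_{i_{v-4}}\in E(\overline{\Gamma}_{i_1,\dots,i_{v-5}})}\frac{R_{i_{v-4}}}{L_{i_{v-4}}+R_{i_{v-4}}}\,Kf(\overline{\Gamma}_{i_1,\dots,i_{v-4}})-\frac{(3v-5)(v-4)}{2}\,y(\Gamma).$$ -/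

import Mathlib

universe u w

/-- A finite multigraph (self-loops and multiple edges allowed) in which every edge carries a
positive length. A metrized graph with a chosen vertex set is such an object that is moreover
connected (`LengthGraph.Connected`). The names `src`, `tgt` of the two end points of an edge
are only a labelling; the graph is undirected. -/
structure LengthGraph where
  V : Type u
  E : Type w
  [fintypeV : Fintype V]
  [fintypeE : Fintype E]
  src : E → V
  tgt : E → V
  len : E → ℝ
  len_pos : ∀ e, 0 < len e

namespace LengthGraph

attribute [instance] LengthGraph.fintypeV LengthGraph.fintypeE

/-- Connectedness (this includes that there is at least one vertex). -/
def Connected (G : LengthGraph.{u, w}) : Prop :=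
  (SimpleGraph.fromRel fun x y : G.V => ∃ e, G.src e = x ∧ G.tgt e = y).Connected

/-- Delete the interior of the edge `e`. -/
noncomputable def delete (G : LengthGraph.{u, w}) (e : G.E) : LengthGraph.{u, w} :=
  letI : Fintype {e' : G.E // e' ≠ e} := Fintype.ofFinite _
  { V := G.V
    E := {e' : G.E // e' ≠ e}
    src := fun e' => G.src e'
    tgt := fun e' => G.tgt e'
    len := fun e' => G.len e'
    len_pos := fun e' => G.len_pos e' }

/-- Contract the edge `e`: it disappears and its two end points are identified. All other edges
remain (edges parallel to `e` become self-loops). -/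
noncomputable def contract (G : LengthGraph.{u, w}) (e : G.E) : LengthGraph.{u, w} :=
  letI : Fintype (Quot fun a b : G.V => a = G.src e ∧ b = G.tgt e) := Fintype.ofFinite _
  letI : Fintype {e' : G.E // e' ≠ e} := Fintype.ofFinite _
  { V := Quot fun a b : G.V => a = G.src e ∧ b = G.tgt e
    E := {e' : G.E // e' ≠ e}
    src := fun e' => Quot.mk _ (G.src e')
    tgt := fun e' => Quot.mk _ (G.tgt e')
    len := fun e' => G.len e'
    len_pos := fun e' => G.len_pos e' }

open Classical in
/-- The net current leaving the vertex `x` through the edges, when the vertices are held at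
potentials `f` and each edge is a resistor of resistance equal to its length. -/
noncomputable def netCurrent (G : LengthGraph.{u, w}) (f : G.V → ℝ) (x : G.V) : ℝ :=
  ∑ e : G.E, ((if G.src e = x then (f (G.src e) - f (G.tgt e)) / G.len e else 0) +
    (if G.tgt e = x then (f (G.tgt e) - f (G.src e)) / G.len e else 0))

open Classical in
/-- `f` is the potential, normalised by `f z = 0`, when unit current enters at `y` and exits
at `z`. -/
def IsVoltage (G : LengthGraph.{u, w}) (z y : G.V) (f : G.V → ℝ) : Prop :=
  f z = 0 ∧ ∀ x, G.netCurrent f x = (if x = y then 1 else 0) - (if x = z then 1 else 0)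

open Classical in
/-- The voltage function `j_z(x, y)` on the vertices. It is used on connected graphs only, where
the potential exists and is unique (`existsUnique_isVoltage`). -/
noncomputable def voltage (G : LengthGraph.{u, w}) (z x y : G.V) : ℝ :=
  if h : ∃ f, G.IsVoltage z y f then h.choose x else 0

/-- The effective resistance `r(x, y) = j_y(x, x)`. -/
noncomputable def resistance (G : LengthGraph.{u, w}) (x y : G.V) : ℝ :=
  G.voltage y x x

/-- The Kirchhoff index. -/
noncomputable def kirchhoffIndex (G : LengthGraph.{u, w}) : ℝ :=
  (1 / 2) * ∑ p : G.V, ∑ q : G.V, G.resistance p q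

/-- `R_i`: the resistance between the end points of `e` in the graph with `e` deleted.
Meaningful if `e` is not a bridge; for bridges `R_i` stands for `∞`, see below. -/
noncomputable def deletedResistance (G : LengthGraph.{u, w}) (e : G.E) : ℝ :=
  (G.delete e).resistance (G.src e) (G.tgt e)

/-- `R_{a_i,p} = j_{p_i}(p, q_i)`, the voltage function being that of the graph with `e`
deleted. -/
noncomputable def Ra (G : LengthGraph.{u, w}) (e : G.E) (p : G.V) : ℝ :=
  (G.delete e).voltage (G.src e) p (G.tgt e)

/-- `R_{b_i,p} = j_{q_i}(p, p_i)`, the voltage function being that of the graph with `e`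
deleted. -/
noncomputable def Rb (G : LengthGraph.{u, w}) (e : G.E) (p : G.V) : ℝ :=
  (G.delete e).voltage (G.tgt e) p (G.src e)

open Classical in
/-- The weight `R_i / (L_i + R_i)`; if `e` is a bridge, its limit `1` as `R_i → ∞`. -/
noncomputable def weight (G : LengthGraph.{u, w}) (e : G.E) : ℝ :=
  if (G.delete e).Connected then
    G.deletedResistance e / (G.len e + G.deletedResistance e)
  else 1

open Classical in
/-- The summand `L_i R_i ^ 2 / (L_i + R_i) ^ 2`; if `e` is a bridge, its limit `L_i` as
`R_i → ∞`. -/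
noncomputable def yTermR (G : LengthGraph.{u, w}) (e : G.E) : ℝ :=
  if (G.delete e).Connected then
    G.len e * G.deletedResistance e ^ 2 / (G.len e + G.deletedResistance e) ^ 2
  else G.len e

open Classical in
/-- The summand `L_i (R_{a_i,p} - R_{b_i,p}) ^ 2 / (L_i + R_i) ^ 2`. If `e` is a bridge, then
one of `R_{a_i,p}`, `R_{b_i,p}` is `R_i` and the other one is `0`, and the summand is again the
limit `L_i` as `R_i → ∞`. -/
noncomputable def yTermAB (G : LengthGraph.{u, w}) (p : G.V) (e : G.E) : ℝ :=
  if (G.delete e).Connected then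
    G.len e * (G.Ra e p - G.Rb e p) ^ 2 / (G.len e + G.deletedResistance e) ^ 2
  else G.len e

/-- The invariant `y`, computed with the base vertex `p`. -/
noncomputable def yInvariant (G : LengthGraph.{u, w}) (p : G.V) : ℝ :=
  (1 / 4) * ∑ e : G.E, G.yTermR e + (3 / 4) * ∑ e : G.E, G.yTermAB p e

open Classical in
/-- The `k`-fold iterated weighted sum
`∑_{e₁ ∈ E(G)} w(e₁) ∑_{e₂ ∈ E(G₁)} w(e₂) ⋯ ∑_{eₖ ∈ E(Gₖ₋₁)} w(eₖ) F(Gₖ)`, where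
`Gⱼ` is `Gⱼ₋₁` with `eⱼ` contracted, over the admissible contractions: at each step only edges
with distinct end points are contracted. The weight at each step is that of the current
graph. -/
noncomputable def contractionSum (F : LengthGraph.{u, w} → ℝ) : ℕ → LengthGraph.{u, w} → ℝ
  | 0, G => F G
  | k + 1, G => ∑ e : G.E with G.src e ≠ G.tgt e,
      G.weight e * contractionSum F k (G.contract e)

theorem sum_mul_netCurrent (G : LengthGraph.{u, w}) (g f : G.V → ℝ) :
    ∑ x, g x * G.netCurrent f x =
      ∑ e, (g (G.src e) - g (G.tgt e)) * (f (G.src e) - f (G.tgt e)) / G.len e := by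
  classical
  simp only [netCurrent, Finset.mul_sum]
  rw [Finset.sum_comm]
  refine Finset.sum_congr rfl fun e _ => ?_
  simp only [mul_add, Finset.sum_add_distrib, mul_ite, mul_zero, Finset.sum_ite_eq,
    Finset.mem_univ, if_true]
  ring

theorem const_of_netCurrent_eq_zero (G : LengthGraph.{u, w}) (hG : G.Connected) (f : G.V → ℝ)
    (hf : ∀ x, G.netCurrent f x = 0) (x y : G.V) : f x = f y := by
  have h0 := G.sum_mul_netCurrent f f
  simp only [hf, mul_zero, Finset.sum_const_zero] at h0
  have hnn : ∀ e ∈ Finset.univ, 0 ≤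
      (f (G.src e) - f (G.tgt e)) * (f (G.src e) - f (G.tgt e)) / G.len e := fun e _ =>
    div_nonneg (mul_self_nonneg _) (G.len_pos e).le
  have he : ∀ e, f (G.src e) = f (G.tgt e) := by
    intro e
    have h := (Finset.sum_eq_zero_iff_of_nonneg hnn).1 h0.symm e (Finset.mem_univ e)
    rcases div_eq_zero_iff.1 h with h | h
    · exact sub_eq_zero.1 (mul_self_eq_zero.1 h)
    · exact absurd h (G.len_pos e).ne'
  obtain ⟨p⟩ := hG.preconnected x y
  induction p with
  | nil => rfl
  | cons h _ ih =>
    refine Eq.trans ?_ ih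
    rcases ((SimpleGraph.fromRel_adj _ _ _).1 h).2 with ⟨e, rfl, rfl⟩ | ⟨e, rfl, rfl⟩
    · exact he e
    · exact (he e).symm

theorem existsUnique_isVoltage (G : LengthGraph.{u, w}) (hG : G.Connected) (z y : G.V) :
    ∃! f, G.IsVoltage z y f := by
  classical
  have hadd : ∀ f g x, G.netCurrent (f + g) x = G.netCurrent f x + G.netCurrent g x := by
    intro f g x
    simp only [netCurrent, ← Finset.sum_add_distrib, Pi.add_apply]
    refine Finset.sum_congr rfl fun e _ => ?_
    split_ifs <;> ring
  have hsmul : ∀ (c : ℝ) f x, G.netCurrent (c • f) x = c * G.netCurrent f x := by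
    intro c f x
    simp only [netCurrent, Finset.mul_sum, Pi.smul_apply, smul_eq_mul]
    refine Finset.sum_congr rfl fun e _ => ?_
    split_ifs <;> ring
  have hsum : ∀ f, ∑ x, G.netCurrent f x = 0 := by
    intro f
    simpa using G.sum_mul_netCurrent (fun _ => 1) f
  let T : (G.V → ℝ) →ₗ[ℝ] (G.V → ℝ) :=
    { toFun := fun f x => G.netCurrent f x + if x = z then f z else 0
      map_add' := by
        intro f g
        funext x
        simp only [hadd, Pi.add_apply]
        split_ifs <;> ring
      map_smul' := by
        intro c f
        funext x
        simp only [hsmul, Pi.smul_apply, smul_eq_mul, RingHom.id_apply]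
        split_ifs <;> ring }
  have hTs : ∀ f, ∑ x, T f x = f z := by
    intro f
    change ∑ x, (G.netCurrent f x + if x = z then f z else 0) = f z
    rw [Finset.sum_add_distrib, hsum]
    simp
  have hinj : Function.Injective T := by
    rw [injective_iff_map_eq_zero]
    intro f hf
    have hz : f z = 0 := by rw [← hTs f, hf]; simp
    have hc : ∀ x, G.netCurrent f x = 0 := by
      intro x
      have h : G.netCurrent f x + (if x = z then f z else 0) = 0 := congrFun hf x
      simpa [hz] using h
    funext x
    rw [G.const_of_netCurrent_eq_zero hG f hc x z, hz]
    rfl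
  have key : ∀ f, G.IsVoltage z y f ↔
      T f = fun x => (if x = y then 1 else 0) - (if x = z then 1 else 0) := by
    intro f
    constructor
    · rintro ⟨h1, h2⟩
      funext x
      change G.netCurrent f x + (if x = z then f z else 0) = _
      rw [h1, h2 x]
      simp
    · intro h
      have hz : f z = 0 := by
        rw [← hTs f, h]
        simp
      refine ⟨hz, fun x => ?_⟩
      have h' : G.netCurrent f x + (if x = z then f z else 0) = _ := congrFun h x
      simpa [hz] using h'
  obtain ⟨f, hf⟩ := LinearMap.injective_iff_surjective.1 hinj
    (fun x => (if x = y then 1 else 0) - (if x = z then 1 else 0))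
  exact ⟨f, (key f).2 hf, fun g hg => hinj (((key g).1 hg).trans hf.symm)⟩

end LengthGraph

/-! Fix a vertex `p` and let g be the Green function `voltage p`, which inverts the Laplacian
grounded at `p`. By `weight_eq` the weight of an edge e = st is r(s,t)/L, bridges included. The
summands of `y` likewise become r(s,t)²/L and (r(s,p) - r(t,p))²/L. Everything is then expressed in
g.

Contracting e is a rank-one update (`voltage_contract`): g'(x,y) = g(x,y) - u(x)u(y)/r, where u =
g(·,s) - g(·,t) and r = r(s,t). The weight contains the factor r, which cancels this denominator, so
the weighted sums over e can be evaluated by Foster's theorem and Thomson's principle. On a graph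
with v vertices this gives ∑ w(e) y(G/e) = (v - 2) y(G), ∑ w(e) Kf(G/e) = (v - 4) Kf(G) + v y(G).
The theorem follows by iterating this triangular recursion: induction on k in
`contractionSum_kirchhoffIndex`. -/

namespace LengthGraph

open Finset

/-- The energy form of the network. -/
noncomputable def energy (G : LengthGraph.{u, w}) (g f : G.V → ℝ) : ℝ :=
  ∑ e, (g (G.src e) - g (G.tgt e)) * (f (G.src e) - f (G.tgt e)) / G.len e

/-! ### The Dirichlet form and its links to voltage and connectedness. -/

section Energy

variable (G : LengthGraph.{u, w})

theorem energy_comm (g f : G.V → ℝ) : G.energy g f = G.energy f g :=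
  sum_congr rfl fun _ _ => by ring

theorem energy_sub_right (g f₁ f₂ : G.V → ℝ) :
    G.energy g (fun x => f₁ x - f₂ x) = G.energy g f₁ - G.energy g f₂ := by
  simp only [energy, ← sum_sub_distrib]
  exact sum_congr rfl fun _ _ => by ring

theorem energy_smul_right (c : ℝ) (g f : G.V → ℝ) :
    G.energy g (fun x => c * f x) = c * G.energy g f := by
  simp only [energy, mul_sum]
  exact sum_congr rfl fun _ _ => by ring

theorem energy_sub_const_right (c : ℝ) (g f : G.V → ℝ) :
    G.energy g (fun x => f x - c) = G.energy g f := by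
  simp only [energy]
  exact sum_congr rfl fun _ _ => by ring

theorem energy_self_nonneg (f : G.V → ℝ) : 0 ≤ G.energy f f :=
  sum_nonneg fun e _ => div_nonneg (mul_self_nonneg _) (G.len_pos e).le

theorem eq_of_energy_self_eq_zero {f : G.V → ℝ} (h : G.energy f f = 0) (e : G.E) :
    f (G.src e) = f (G.tgt e) := by
  have h := (sum_eq_zero_iff_of_nonneg fun e _ =>
    div_nonneg (mul_self_nonneg _) (G.len_pos e).le).1 h e (mem_univ e)
  rcases div_eq_zero_iff.1 h with h | h
  · exact sub_eq_zero.1 (mul_self_eq_zero.1 h)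
  · exact absurd h (G.len_pos e).ne'

/-- Weak formulation of the voltage equation. -/
theorem isVoltage_iff_energy (z y : G.V) (f : G.V → ℝ) :
    G.IsVoltage z y f ↔ f z = 0 ∧ ∀ g, G.energy g f = g y - g z := by
  classical
  refine and_congr_right fun _ => ⟨fun h g => ?_, fun h x => ?_⟩
  · rw [energy, ← sum_mul_netCurrent]
    simp [h, mul_sub]
  · have h := h (fun a => if a = x then 1 else 0)
    rw [energy, ← sum_mul_netCurrent G (fun a => if a = x then 1 else 0)] at h
    simpa [eq_comm] using h

/-- Connectedness in terms of locally constant functions. -/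
theorem connected_iff_forall_const :
    G.Connected ↔ Nonempty G.V ∧ ∀ f : G.V → ℝ,
      (∀ e, f (G.src e) = f (G.tgt e)) → ∀ x y, f x = f y := by
  classical
  constructor
  · intro h
    refine ⟨h.nonempty, fun f hf => G.const_of_netCurrent_eq_zero h f fun x => ?_⟩
    simp [netCurrent, hf]
  · rintro ⟨hne, h⟩
    refine (SimpleGraph.connected_iff _).2 ⟨fun x y => ?_, hne⟩
    by_contra hxy
    -- The indicator of the component of `x` is constant along every edge, yet separates `x` from
    -- `y`.
    have := h (fun a => if (SimpleGraph.fromRel fun x y : G.V =>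
      ∃ e, G.src e = x ∧ G.tgt e = y).Reachable x a then 1 else 0) (fun e => ?_) x y
    · simp [hxy] at this
    · by_cases hl : G.src e = G.tgt e
      · simp only [hl]
      · have ha : (SimpleGraph.fromRel fun x y : G.V =>
            ∃ e, G.src e = x ∧ G.tgt e = y).Adj (G.src e) (G.tgt e) :=
          (SimpleGraph.fromRel_adj _ _ _).2 ⟨hl, Or.inl ⟨e, rfl, rfl⟩⟩
        have : (SimpleGraph.fromRel fun x y : G.V =>
            ∃ e, G.src e = x ∧ G.tgt e = y).Reachable x (G.src e) ↔
          (SimpleGraph.fromRel fun x y : G.V =>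
            ∃ e, G.src e = x ∧ G.tgt e = y).Reachable x (G.tgt e) :=
          ⟨fun h => h.trans ha.reachable, fun h => h.trans ha.symm.reachable⟩
        simp only [this]

end Energy

/-! ### Green function, effective resistance, Foster and Thomson identities. -/

section Voltage

variable {G : LengthGraph.{u, w}} (hG : G.Connected)
include hG

theorem isVoltage_voltage (z y : G.V) : G.IsVoltage z y (fun x => G.voltage z x y) := by
  have h : ∃ f, G.IsVoltage z y f := (G.existsUnique_isVoltage hG z y).exists
  simpa only [voltage, dif_pos h] using h.choose_spec

theorem voltage_eq_of_isVoltage {z y : G.V} {f : G.V → ℝ} (hf : G.IsVoltage z y f) (x : G.V) :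
    G.voltage z x y = f x :=
  congrFun ((G.existsUnique_isVoltage hG z y).unique (isVoltage_voltage hG z y) hf) x

theorem voltage_base (z y : G.V) : G.voltage z z y = 0 :=
  (isVoltage_voltage hG z y).1

theorem energy_voltage (z y : G.V) (g : G.V → ℝ) :
    G.energy g (fun x => G.voltage z x y) = g y - g z :=
  ((G.isVoltage_iff_energy z y _).1 (isVoltage_voltage hG z y)).2 g

/-- Reciprocity: each potential is tested against the other in the symmetric energy form. -/
theorem voltage_symm (z x y : G.V) : G.voltage z x y = G.voltage z y x := by
  have h := energy_voltage hG z x (fun a => G.voltage z a y)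
  rw [energy_comm, energy_voltage hG] at h
  simp only [voltage_base hG] at h
  linarith

theorem voltage_base_right (z x : G.V) : G.voltage z x z = 0 := by
  rw [voltage_symm hG, voltage_base hG]

/-- Superposition: a unit current from `y` to `z` is one from `y` to `p` minus one from `z` to `p`;
a constant then moves the zero to `z`. -/
theorem voltage_eq_change_base (p z x y : G.V) :
    G.voltage z x y = G.voltage p x y - G.voltage p x z -
      (G.voltage p z y - G.voltage p z z) := by
  refine voltage_eq_of_isVoltage hG (f := fun x => G.voltage p x y - G.voltage p x z -
      (G.voltage p z y - G.voltage p z z)) ((G.isVoltage_iff_energy _ _ _).2 ⟨by ring, fun g => ?_⟩) x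
  rw [energy_sub_const_right, energy_sub_right, energy_voltage hG, energy_voltage hG]
  ring

theorem resistance_eq_voltage (p x y : G.V) :
    G.resistance x y = G.voltage p x x + G.voltage p y y - 2 * G.voltage p x y := by
  rw [resistance, voltage_eq_change_base hG p, voltage_symm hG p y x]
  ring

theorem resistance_self (x : G.V) : G.resistance x x = 0 := voltage_base hG x x

theorem resistance_comm (x y : G.V) : G.resistance x y = G.resistance y x := by
  rw [resistance_eq_voltage hG x, resistance_eq_voltage hG x, voltage_symm hG x x y]
  ring

theorem resistance_pos {x y : G.V} (hxy : x ≠ y) : 0 < G.resistance x y := by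
  classical
  have h := energy_voltage hG y x (fun a => G.voltage y a x)
  rw [voltage_base hG, sub_zero] at h
  refine lt_of_le_of_ne ((G.energy_self_nonneg _).trans_eq h) fun h0 => ?_
  have hc := G.eq_of_energy_self_eq_zero (h.trans h0.symm)
  -- Zero energy makes the potential constant along edges, so no current flows; testing with the
  -- indicator of `x` would give 0 = 1.
  have h1 := energy_voltage hG y x (fun a => if a = x then 1 else 0)
  simp [energy, hc, hxy.symm] at h1

/-- Thomson's principle: the power dissipated by a unit current is the resistance. -/
theorem sum_sq_voltage_sub (p x y : G.V) :
    ∑ e, ((G.voltage p x (G.src e) - G.voltage p x (G.tgt e)) -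
      (G.voltage p y (G.src e) - G.voltage p y (G.tgt e))) ^ 2 / G.len e = G.resistance x y := by
  have h : G.energy (fun a => G.voltage p a x - G.voltage p a y)
      (fun a => G.voltage p a x - G.voltage p a y) = G.resistance x y := by
    rw [energy_sub_right, energy_voltage hG, energy_voltage hG, resistance_eq_voltage hG p,
      voltage_symm hG p y x]
    simp only [voltage_base hG]
    ring
  rw [← h, energy]
  refine sum_congr rfl fun e _ => ?_
  rw [voltage_symm hG p x, voltage_symm hG p x, voltage_symm hG p y, voltage_symm hG p y]
  ring

/-- A weighted trace of Laplacian times Green function, regrouped by edges. The weight `a = 1`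
yields Foster's theorem; `a = r(·, y)` serves the Kirchhoff recursion. -/
theorem sum_edge_voltage (p : G.V) (a : G.V → ℝ) :
    ∑ e, (a (G.src e) * (G.voltage p (G.src e) (G.src e) - G.voltage p (G.src e) (G.tgt e)) +
      a (G.tgt e) * (G.voltage p (G.tgt e) (G.tgt e) - G.voltage p (G.src e) (G.tgt e))) /
        G.len e = ∑ x, a x - a p := by
  classical
  have h : ∑ x, a x * G.netCurrent (fun z => G.voltage p z x) x = ∑ x, a x - a p := by
    simp [(isVoltage_voltage hG p _).2, mul_sub]
  rw [← h]
  simp only [netCurrent, mul_sum]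
  rw [sum_comm]
  refine sum_congr rfl fun e _ => ?_
  simp only [mul_add, sum_add_distrib, mul_ite, mul_zero, sum_ite_eq, mem_univ, if_true]
  rw [voltage_symm hG p (G.tgt e) (G.src e)]
  ring

/-- Foster's theorem. -/
theorem sum_resistance_div_len :
    ∑ e, G.resistance (G.src e) (G.tgt e) / G.len e = Fintype.card G.V - 1 := by
  obtain ⟨p⟩ := hG.nonempty
  have h := sum_edge_voltage hG p fun _ => 1
  simp only [sum_const, card_univ, nsmul_eq_mul, mul_one, one_mul] at h
  rw [← h]
  refine sum_congr rfl fun e _ => ?_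
  rw [resistance_eq_voltage hG p]
  ring

end Voltage

/-! ### Weights and the invariant `y` in terms of the Green function. -/

section Delete

variable (G : LengthGraph.{u, w}) (e : G.E)

theorem sum_subtype_ne (φ : G.E → ℝ) [Fintype {e' : G.E // e' ≠ e}] :
    ∑ e' : {e' : G.E // e' ≠ e}, φ e' = ∑ e', φ e' - φ e := by
  classical
  rw [eq_sub_iff_add_eq, Fintype.sum_eq_add_sum_subtype_ne φ e, add_comm]
  congr 1
  exact sum_congr (by ext; simp) fun _ _ => rfl

theorem energy_delete (g f : G.V → ℝ) :
    (G.delete e).energy g f = G.energy g f -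
      (g (G.src e) - g (G.tgt e)) * (f (G.src e) - f (G.tgt e)) / G.len e :=
  @sum_subtype_ne G e (fun e => (g (G.src e) - g (G.tgt e)) * (f (G.src e) - f (G.tgt e)) /
    G.len e) (G.delete e).fintypeE

variable {G} {e}

/-- Restoring `e` puts a resistor L in parallel with R, so the potential of the deleted graph is
merely scaled by L/(L + R). -/
theorem isVoltage_of_delete (hd : (G.delete e).Connected) :
    0 ≤ G.deletedResistance e ∧ ∀ x, G.Ra e x = G.deletedResistance e - G.Rb e x ∧
    G.IsVoltage (G.tgt e) (G.src e)
      (fun x => G.len e / (G.len e + G.deletedResistance e) * G.Rb e x) := by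
  have hpos := G.len_pos e
  have h0 : 0 ≤ G.deletedResistance e := by
    have h := energy_voltage hd (G.tgt e) (G.src e)
      (fun x => (G.delete e).voltage (G.tgt e) x (G.src e))
    have hb : (G.delete e).voltage (G.tgt e) (G.tgt e) (G.src e) = 0 := voltage_base hd _ _
    have hn := (G.delete e).energy_self_nonneg
      (fun x => (G.delete e).voltage (G.tgt e) x (G.src e))
    change 0 ≤ (G.delete e).voltage (G.tgt e) (G.src e) (G.src e)
    linarith
  refine ⟨h0, fun x => ⟨?_, ?_⟩⟩
  · have h := voltage_eq_change_base hd (G.tgt e) (G.src e) x (G.tgt e)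
    have hb : ∀ x, (G.delete e).voltage (G.tgt e) x (G.tgt e) = 0 := voltage_base_right hd _
    have hb1 := hb x
    have hb2 := hb (G.src e)
    change (G.delete e).voltage (G.src e) x (G.tgt e) =
      (G.delete e).voltage (G.tgt e) (G.src e) (G.src e) - (G.delete e).voltage (G.tgt e) x (G.src e)
    linarith
  · have hb : G.Rb e (G.tgt e) = 0 := voltage_base hd (G.tgt e) (G.src e)
    have hs : G.Rb e (G.src e) = G.deletedResistance e := rfl
    refine (G.isVoltage_iff_energy _ _ _).2 ⟨by rw [hb, mul_zero], fun g => ?_⟩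
    have h := energy_voltage hd (G.tgt e) (G.src e) g
    have h2 := G.energy_delete e g (fun x => G.Rb e x)
    rw [hb, hs] at h2
    rw [energy_smul_right]
    have h3 : G.energy g (G.Rb e) = (g (G.src e) - g (G.tgt e)) *
        (1 + G.deletedResistance e / G.len e) := by
      change (G.delete e).energy g (fun x => G.Rb e x) = _ at h
      have h2 := h.symm.trans h2
      have : G.energy g (G.Rb e) = g (G.src e) - g (G.tgt e) +
        (g (G.src e) - g (G.tgt e)) * (G.deletedResistance e - 0) / G.len e := by linarith
      rw [this]; ring
    rw [h3]
    have : G.len e + G.deletedResistance e ≠ 0 := by positivity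
    field_simp

/-- Across a bridge all the current passes through `e`, so the potential is L on the source side and
0 on the other. -/
theorem exists_cut_of_not_connected_delete (hG : G.Connected) (hd : ¬ (G.delete e).Connected) :
    ∃ χ : G.V → ℝ, (∀ x, χ x = 0 ∨ χ x = 1) ∧
      G.IsVoltage (G.tgt e) (G.src e) (fun x => G.len e * χ x) ∧ χ (G.src e) = 1 := by
  classical
  have hpos := G.len_pos e
  obtain ⟨f, hf, x, y, hxy⟩ : ∃ f : G.V → ℝ,
      (∀ e', e' ≠ e → f (G.src e') = f (G.tgt e')) ∧ ∃ x y, f x ≠ f y := by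
    -- A non-constant function without jumps off `e` must jump across `e`, since `G` is connected;
    -- its level set through the source is the cut.
    by_contra! hcon
    exact hd ((G.delete e).connected_iff_forall_const.2 ⟨hG.nonempty, fun f hf =>
      hcon f fun e' he' => hf ⟨e', he'⟩⟩)
  have hst : f (G.src e) ≠ f (G.tgt e) := fun h => hxy <|
    (G.connected_iff_forall_const.1 hG).2 f (fun e' => by
      by_cases he : e' = e
      · rw [he, h]
      · exact hf e' he) x y
  have hen : ∀ g, G.energy g (fun x => G.len e * if f x = f (G.src e) then 1 else 0) =
      g (G.src e) - g (G.tgt e) := fun g => by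
    rw [energy, sum_eq_single e]
    · simp only [if_true, hst.symm, if_false]
      field_simp
      ring
    · intro e' _ he'
      simp [hf e' he']
    · simp
  refine ⟨fun x => if f x = f (G.src e) then 1 else 0, fun x => by dsimp; split_ifs <;> simp,
    (G.isVoltage_iff_energy _ _ _).2 ⟨by simp [hst.symm], hen⟩, by simp⟩

variable (hG : G.Connected) (e)
include hG

theorem weight_eq : G.weight e = G.resistance (G.src e) (G.tgt e) / G.len e := by
  have hpos := G.len_pos e
  by_cases hd : (G.delete e).Connected
  · obtain ⟨h0, h⟩ := isVoltage_of_delete hd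
    have hr : G.resistance (G.src e) (G.tgt e) = _ := voltage_eq_of_isVoltage hG (h (G.src e)).2 _
    rw [weight, if_pos hd, hr]
    change _ = _ * G.deletedResistance e / _
    field_simp
  · obtain ⟨χ, -, h, hs⟩ := exists_cut_of_not_connected_delete hG hd
    have hr : G.resistance (G.src e) (G.tgt e) = _ := voltage_eq_of_isVoltage hG h _
    rw [weight, if_neg hd, hr, hs]
    field_simp

theorem yTermR_eq : G.yTermR e = G.resistance (G.src e) (G.tgt e) ^ 2 / G.len e := by
  have hpos := G.len_pos e
  have hw := weight_eq e hG
  have hr : G.resistance (G.src e) (G.tgt e) = G.weight e * G.len e := by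
    rw [hw]; field_simp
  rw [hr, yTermR, weight]
  split_ifs
  · field_simp
  · field_simp

/-- With j the potential of a unit current from s to t, r(s,p) - r(t,p) = r(s,t) - 2j(p). Off
bridges this is Ra - Rb scaled by L/(L + R); at a bridge r(s,t) = L and j(p) is 0 or L, so the
square is L². -/
theorem yTermAB_eq (p : G.V) : G.yTermAB p e =
    (G.resistance (G.src e) p - G.resistance (G.tgt e) p) ^ 2 / G.len e := by
  have hpos := G.len_pos e
  have key : G.resistance (G.src e) p - G.resistance (G.tgt e) p =
      G.resistance (G.src e) (G.tgt e) - 2 * G.voltage (G.tgt e) p (G.src e) := by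
    rw [resistance_eq_voltage hG (G.tgt e), resistance_eq_voltage hG (G.tgt e),
      resistance_eq_voltage hG (G.tgt e), voltage_symm hG _ p (G.src e)]
    simp only [voltage_base hG, voltage_base_right hG]
    ring
  rw [key]
  by_cases hd : (G.delete e).Connected
  · obtain ⟨h0, h⟩ := isVoltage_of_delete hd
    have hr : G.resistance (G.src e) (G.tgt e) = _ := voltage_eq_of_isVoltage hG (h p).2 _
    rw [yTermAB, if_pos hd, hr, voltage_eq_of_isVoltage hG (h p).2, (h p).1]
    change _ = (_ * G.deletedResistance e - _) ^ 2 / _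
    field_simp
    ring
  · obtain ⟨χ, h01, h, hs⟩ := exists_cut_of_not_connected_delete hG hd
    have hr : G.resistance (G.src e) (G.tgt e) = _ := voltage_eq_of_isVoltage hG h _
    rw [yTermAB, if_neg hd, hr, hs, voltage_eq_of_isVoltage hG h]
    rcases h01 p with h | h <;> rw [h] <;> field_simp <;> ring

omit e in
/-- The invariant `y` in terms of the Green function grounded at the base vertex. -/
theorem yInvariant_eq_sum_voltage (p : G.V) : G.yInvariant p =
    ∑ e, (1 / 4 * (G.voltage p (G.src e) (G.src e) + G.voltage p (G.tgt e) (G.tgt e) -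
        2 * G.voltage p (G.src e) (G.tgt e)) ^ 2 +
      3 / 4 * (G.voltage p (G.src e) (G.src e) - G.voltage p (G.tgt e) (G.tgt e)) ^ 2) /
        G.len e := by
  rw [yInvariant, mul_sum, mul_sum, ← sum_add_distrib]
  refine sum_congr rfl fun e _ => ?_
  rw [yTermR_eq e hG, yTermAB_eq e hG, resistance_eq_voltage hG p]
  change _ + _ * ((G.voltage p _ _ - G.voltage p _ _) ^ 2 / _) = _
  ring

omit e in
-- With d(x) = g(x,x), the sum based at `q` is the energy of d - 2g(·,q). Its cross term -4d(q) and
-- square term 4g(q,q) cancel, leaving the energy of d.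
theorem yInvariant_base_indep (p q : G.V) : G.yInvariant p = G.yInvariant q := by
  have hE : ∀ q, ∑ e, G.yTermAB q e =
      G.energy (fun x => G.voltage p x x) (fun x => G.voltage p x x) := by
    intro q
    have h1 : ∑ e, G.yTermAB q e = G.energy
        (fun x => G.voltage p x x - 2 * G.voltage p x q)
        (fun x => G.voltage p x x - 2 * G.voltage p x q) := by
      refine sum_congr rfl fun e _ => ?_
      rw [yTermAB_eq e hG, resistance_eq_voltage hG p, resistance_eq_voltage hG p]
      ring
    rw [h1, energy_sub_right, energy_smul_right, energy_voltage hG, energy_comm,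
      energy_sub_right, energy_smul_right, energy_voltage hG]
    simp only [voltage_base hG]
    ring
  rw [yInvariant, yInvariant, hE, hE]

end Delete

/-! ### Contraction of an edge as a rank-one update. -/

section Contract

/-- The projection from the vertices of `G` to those of the contraction of `e`. -/
def contractMk (G : LengthGraph.{u, w}) (e : G.E) (x : G.V) : (G.contract e).V :=
  Quot.mk _ x

variable {G : LengthGraph.{u, w}} (e : G.E)

theorem contractMk_src_eq_tgt : G.contractMk e (G.src e) = G.contractMk e (G.tgt e) :=
  Quot.sound ⟨rfl, rfl⟩

theorem contractMk_surjective : Function.Surjective (G.contractMk e) := Quot.mk_surjective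

/-- Functions on the vertices of the contraction are functions on the vertices of `G` that agree
at the end points of `e`. -/
theorem exists_contract_lift {f : G.V → ℝ} (hf : f (G.src e) = f (G.tgt e)) :
    ∃ F : (G.contract e).V → ℝ, ∀ x, F (G.contractMk e x) = f x :=
  ⟨Quot.lift f fun a b h => by rw [h.1, h.2, hf], fun _ => rfl⟩

theorem sum_contract_E (φ : G.E → ℝ) (h : φ e = 0) :
    ∑ e' : (G.contract e).E, φ e'.1 = ∑ e', φ e' :=
  (@sum_subtype_ne G e φ (G.contract e).fintypeE).trans (by rw [h, sub_zero])

theorem energy_contract (g f : (G.contract e).V → ℝ) :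
    (G.contract e).energy g f =
      G.energy (fun x => g (G.contractMk e x)) (fun x => f (G.contractMk e x)) :=
  sum_contract_E e (fun e' => (g (G.contractMk e (G.src e')) - g (G.contractMk e (G.tgt e'))) *
    (f (G.contractMk e (G.src e')) - f (G.contractMk e (G.tgt e'))) / G.len e')
    (by simp [contractMk_src_eq_tgt])

theorem connected_contract (hG : G.Connected) : (G.contract e).Connected := by
  obtain ⟨hne, hc⟩ := G.connected_iff_forall_const.1 hG
  refine (G.contract e).connected_iff_forall_const.2 ⟨hne.map (G.contractMk e), fun f hf x y => ?_⟩
  obtain ⟨x, rfl⟩ := contractMk_surjective e x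
  obtain ⟨y, rfl⟩ := contractMk_surjective e y
  refine hc (fun x => f (G.contractMk e x)) (fun e' => ?_) x y
  by_cases he : e' = e
  · rw [he, contractMk_src_eq_tgt]
  · exact hf ⟨e', he⟩

variable {e} (he : G.src e ≠ G.tgt e)
include he

theorem contractMk_bijective_subtype :
    Function.Bijective fun x : {x : G.V // x ≠ G.tgt e} => G.contractMk e x := by
  classical
  constructor
  · intro x y hxy
    -- The retraction sending the target of `e` to its source descends to the quotient and separates
    -- the remaining vertices.
    have := congrArg (Quot.lift (fun a => if a = G.tgt e then G.src e else a)
      (fun a b h => by rw [h.1, h.2, if_neg he, if_pos rfl])) hxy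
    change (if _ then _ else _) = (if _ then _ else _) at this
    rw [if_neg x.2, if_neg y.2] at this
    exact Subtype.ext this
  · intro c
    obtain ⟨x, rfl⟩ := contractMk_surjective e c
    by_cases hx : x = G.tgt e
    · exact ⟨⟨G.src e, he⟩, by rw [hx, ← contractMk_src_eq_tgt]⟩
    · exact ⟨⟨x, hx⟩, rfl⟩

theorem sum_contract_V (F : (G.contract e).V → ℝ) :
    ∑ c, F c = ∑ x, F (G.contractMk e x) - F (G.contractMk e (G.src e)) := by
  classical
  rw [← (contractMk_bijective_subtype he).sum_comp, eq_sub_iff_add_eq,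
    Fintype.sum_eq_add_sum_subtype_ne (fun x => F (G.contractMk e x)) (G.tgt e), add_comm,
    contractMk_src_eq_tgt]

theorem card_contract : (Fintype.card (G.contract e).V : ℝ) = Fintype.card G.V - 1 := by
  simpa using sum_contract_V he fun _ => 1

variable (hG : G.Connected)
include hG

/-- The Green function of the contraction. -/
theorem voltage_contract (p x y : G.V) :
    (G.contract e).voltage (G.contractMk e p) (G.contractMk e x) (G.contractMk e y) =
      G.voltage p x y - (G.voltage p x (G.src e) - G.voltage p x (G.tgt e)) *
        (G.voltage p y (G.src e) - G.voltage p y (G.tgt e)) /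
          G.resistance (G.src e) (G.tgt e) := by
  have hr := (resistance_pos hG he).ne'
  -- This multiple of u makes the corrected potential agree at the two ends of `e`, so that it
  -- descends.
  set c := (G.voltage p y (G.src e) - G.voltage p y (G.tgt e)) /
    G.resistance (G.src e) (G.tgt e) with hc
  obtain ⟨F, hF⟩ := exists_contract_lift e (f := fun x => G.voltage p x y -
    c * (G.voltage p x (G.src e) - G.voltage p x (G.tgt e))) (by
      have h : c * G.resistance (G.src e) (G.tgt e) =
        G.voltage p y (G.src e) - G.voltage p y (G.tgt e) := by rw [hc]; field_simp
      rw [resistance_eq_voltage hG p, voltage_symm hG p y, voltage_symm hG p y] at h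
      rw [voltage_symm hG p (G.tgt e) (G.src e)]
      linarith)
  rw [voltage_eq_of_isVoltage (connected_contract e hG) (f := F), hF, hc]
  · ring
  · refine ((G.contract e).isVoltage_iff_energy _ _ _).2 ⟨?_, fun g => ?_⟩
    · rw [hF]
      simp only [voltage_base hG]
      ring
    · rw [energy_contract]
      simp only [hF]
      rw [energy_sub_right, energy_smul_right, energy_sub_right, energy_voltage hG,
        energy_voltage hG, energy_voltage hG, contractMk_src_eq_tgt]
      ring

theorem resistance_contract (p x y : G.V) :
    (G.contract e).resistance (G.contractMk e x) (G.contractMk e y) =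
      G.resistance x y - ((G.voltage p x (G.src e) - G.voltage p x (G.tgt e)) -
        (G.voltage p y (G.src e) - G.voltage p y (G.tgt e))) ^ 2 /
          G.resistance (G.src e) (G.tgt e) := by
  rw [resistance_eq_voltage (connected_contract e hG) (G.contractMk e p),
    voltage_contract he hG, voltage_contract he hG, voltage_contract he hG,
    resistance_eq_voltage hG p x y]
  ring

/-- A double sum over the vertices of `G` counts the merged vertex twice in each variable, hence the
subtracted row. In that row u(s) - u(y) = (r(s,t) + r(s,y) - r(t,y))/2. Multiplying by r gives a
formula that also makes sense at loops. -/
theorem kirchhoffIndex_contract (p : G.V) :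
    G.resistance (G.src e) (G.tgt e) * (G.contract e).kirchhoffIndex =
      1 / 2 * ∑ x, ∑ y, (G.resistance (G.src e) (G.tgt e) * G.resistance x y -
        ((G.voltage p x (G.src e) - G.voltage p x (G.tgt e)) -
          (G.voltage p y (G.src e) - G.voltage p y (G.tgt e))) ^ 2) -
      ∑ y, (G.resistance (G.src e) (G.tgt e) * G.resistance (G.src e) y -
        (G.resistance (G.src e) (G.tgt e) + G.resistance (G.src e) y -
          G.resistance (G.tgt e) y) ^ 2 / 4) := by
  have hr := (resistance_pos hG he).ne'
  have hG' := connected_contract e hG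
  have h1 : (G.contract e).kirchhoffIndex =
      1 / 2 * ∑ x, ∑ y, (G.contract e).resistance (G.contractMk e x) (G.contractMk e y) -
        ∑ y, (G.contract e).resistance (G.contractMk e (G.src e)) (G.contractMk e y) := by
    rw [kirchhoffIndex, sum_contract_V he]
    simp only [sum_contract_V he, sum_sub_distrib, resistance_self hG']
    rw [sum_congr rfl fun x _ => resistance_comm hG' (G.contractMk e x)
      (G.contractMk e (G.src e))]
    ring
  have h2 : ∀ x y, G.resistance (G.src e) (G.tgt e) *
      (G.contract e).resistance (G.contractMk e x) (G.contractMk e y) =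
      G.resistance (G.src e) (G.tgt e) * G.resistance x y -
        ((G.voltage p x (G.src e) - G.voltage p x (G.tgt e)) -
          (G.voltage p y (G.src e) - G.voltage p y (G.tgt e))) ^ 2 := fun x y => by
    rw [resistance_contract he hG p]
    field_simp
  rw [h1, mul_sub, mul_left_comm]
  simp only [mul_sum, h2]
  congr 1
  refine sum_congr rfl fun y _ => ?_
  simp only [resistance_eq_voltage hG p]
  rw [voltage_symm hG p (G.src e) y, voltage_symm hG p (G.tgt e) y]
  ring

/-- The `y` invariant of the contraction. -/
theorem yInvariant_contract (p : G.V) :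
    G.resistance (G.src e) (G.tgt e) * (G.contract e).yInvariant (G.contractMk e p) =
      G.resistance (G.src e) (G.tgt e) * G.yInvariant p -
      ∑ f, (1 / 2 * G.resistance (G.src f) (G.tgt f) *
          ((G.voltage p (G.src e) (G.src f) - G.voltage p (G.src e) (G.tgt f)) -
            (G.voltage p (G.tgt e) (G.src f) - G.voltage p (G.tgt e) (G.tgt f))) ^ 2 +
        3 / 2 * (G.voltage p (G.src f) (G.src f) - G.voltage p (G.tgt f) (G.tgt f)) *
          ((G.voltage p (G.src e) (G.src f) - G.voltage p (G.tgt e) (G.src f)) ^ 2 -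
            (G.voltage p (G.src e) (G.tgt f) - G.voltage p (G.tgt e) (G.tgt f)) ^ 2)) / G.len f +
      (1 / 4 * G.resistance (G.src e) (G.tgt e) ^ 2 +
        3 / 4 * (G.voltage p (G.src e) (G.src e) - G.voltage p (G.tgt e) (G.tgt e)) ^ 2) := by
  have hr := (resistance_pos hG he).ne'
  set r := G.resistance (G.src e) (G.tgt e) with hr_def
  have hG' := connected_contract e hG
  -- `u` is the potential of a unit current from `G.src e` to `G.tgt e`, vanishing at `p`.
  set u : G.V → ℝ := fun x => G.voltage p x (G.src e) - G.voltage p x (G.tgt e) with hu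
  -- The coefficients 1/4 and 3/4 enter here: (a - b)⁴/4 + 3(a² - b²)²/4 = (a - b)(a³ - b³). The
  -- terms quartic in u thus sum to the energy pairing of u³ with u, which is u(s)³ - u(t)³.
  have hcube := energy_sub_right G (fun x => u x ^ 3) (fun x => G.voltage p x (G.src e))
    (fun x => G.voltage p x (G.tgt e))
  rw [energy_voltage hG, energy_voltage hG] at hcube
  change G.energy (fun x => u x ^ 3) u = _ at hcube
  have hus : u (G.src e) - u (G.tgt e) = r := by
    rw [hr_def, resistance_eq_voltage hG p, hu]
    simp only [voltage_symm hG p (G.tgt e) (G.src e)]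
    ring
  have hut : u (G.src e) + u (G.tgt e) =
      G.voltage p (G.src e) (G.src e) - G.voltage p (G.tgt e) (G.tgt e) := by
    simp only [hu, voltage_symm hG p (G.tgt e) (G.src e)]
    ring
  have hcube' : G.energy (fun x => u x ^ 3) u / r = 1 / 4 * r ^ 2 +
      3 / 4 * (G.voltage p (G.src e) (G.src e) - G.voltage p (G.tgt e) (G.tgt e)) ^ 2 := by
    rw [hcube, ← hut, div_eq_iff hr, ← hus]
    ring
  have hsum : (G.contract e).yInvariant (G.contractMk e p) =
      ∑ f, (1 / 4 * (G.resistance (G.src f) (G.tgt f) - (u (G.src f) - u (G.tgt f)) ^ 2 / r) ^ 2 +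
        3 / 4 * (G.voltage p (G.src f) (G.src f) - G.voltage p (G.tgt f) (G.tgt f) -
          (u (G.src f) ^ 2 - u (G.tgt f) ^ 2) / r) ^ 2) / G.len f := by
    rw [← sum_contract_E e, yInvariant_eq_sum_voltage hG']
    · refine sum_congr rfl fun f _ => ?_
      have h1 := voltage_contract he hG p (G.src f.1) (G.src f.1)
      have h2 := voltage_contract he hG p (G.tgt f.1) (G.tgt f.1)
      have h3 := voltage_contract he hG p (G.src f.1) (G.tgt f.1)
      change (1 / 4 * ((G.contract e).voltage _ (G.contractMk e (G.src f.1))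
        (G.contractMk e (G.src f.1)) + (G.contract e).voltage _ (G.contractMk e (G.tgt f.1))
        (G.contractMk e (G.tgt f.1)) - 2 * (G.contract e).voltage _ (G.contractMk e (G.src f.1))
        (G.contractMk e (G.tgt f.1))) ^ 2 + 3 / 4 * ((G.contract e).voltage _
        (G.contractMk e (G.src f.1)) (G.contractMk e (G.src f.1)) -
        (G.contract e).voltage _ (G.contractMk e (G.tgt f.1))
        (G.contractMk e (G.tgt f.1))) ^ 2) / G.len f.1 = _
      rw [h1, h2, h3, ← hr_def, resistance_eq_voltage hG p (G.src f.1)]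
      simp only [hu]
      ring
    -- The summand at `e` itself vanishes, so the sum may run over all edges of `G`.
    · rw [hus, ← hr_def, ← hut, ← hus]
      have : u (G.src e) - u (G.tgt e) ≠ 0 := hus ▸ hr
      field_simp
      ring
  rw [hsum, ← hcube', yInvariant_eq_sum_voltage hG, energy, mul_sum, mul_sum, sum_div,
    ← sum_sub_distrib, ← sum_add_distrib]
  refine sum_congr rfl fun f _ => ?_
  have hpos := G.len_pos f
  rw [voltage_symm hG p (G.src e) (G.src f), voltage_symm hG p (G.src e) (G.tgt f),
    voltage_symm hG p (G.tgt e) (G.src f), voltage_symm hG p (G.tgt e) (G.tgt f),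
    resistance_eq_voltage hG p (G.src f)]
  simp only [hu]
  field_simp
  ring

end Contract

/-! ### The two contraction recursions and their iteration. -/

section Recursion

variable {G : LengthGraph.{u, w}} (hG : G.Connected)
include hG

/-- A weighted sum over the edges with distinct end points, the summand being given by a formula
that vanishes at loops. -/
theorem sum_weight_mul_eq [DecidablePred fun e : G.E => G.src e ≠ G.tgt e]
    (X φ : G.E → ℝ)
    (h : ∀ e, G.src e ≠ G.tgt e → G.resistance (G.src e) (G.tgt e) * X e = φ e)
    (h0 : ∀ e, G.src e = G.tgt e → φ e = 0) :
    ∑ e : G.E with G.src e ≠ G.tgt e, G.weight e * X e = ∑ e, φ e / G.len e := by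
  rw [sum_filter]
  refine sum_congr rfl fun e _ => ?_
  split_ifs with he
  · rw [weight_eq e hG, ← h e he]
    ring
  · rw [h0 e (not_not.1 he), zero_div]

/-- The coefficient is (v - 1) - 2 + 1: Foster's theorem for the main term, Thomson's principle for
the cross terms, and the quartic terms reproducing `y`. -/
theorem sum_weight_mul_yInvariant_contract [DecidablePred fun e : G.E => G.src e ≠ G.tgt e]
    (p : G.V) :
    ∑ e : G.E with G.src e ≠ G.tgt e,
        G.weight e * (G.contract e).yInvariant (G.contractMk e p) =
      (Fintype.card G.V - 2) * G.yInvariant p := by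
  rw [sum_weight_mul_eq hG _ _ (fun e he => yInvariant_contract he hG p)]
  · have h1 : ∑ e, G.resistance (G.src e) (G.tgt e) * G.yInvariant p / G.len e =
        (Fintype.card G.V - 1) * G.yInvariant p := by
      rw [← sum_resistance_div_len hG, sum_mul]
      exact sum_congr rfl fun e _ => by ring
    have h2 : ∑ e, (∑ f, (1 / 2 * G.resistance (G.src f) (G.tgt f) *
          ((G.voltage p (G.src e) (G.src f) - G.voltage p (G.src e) (G.tgt f)) -
            (G.voltage p (G.tgt e) (G.src f) - G.voltage p (G.tgt e) (G.tgt f))) ^ 2 +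
        3 / 2 * (G.voltage p (G.src f) (G.src f) - G.voltage p (G.tgt f) (G.tgt f)) *
          ((G.voltage p (G.src e) (G.src f) - G.voltage p (G.tgt e) (G.src f)) ^ 2 -
            (G.voltage p (G.src e) (G.tgt f) - G.voltage p (G.tgt e) (G.tgt f)) ^ 2)) /
              G.len f) / G.len e = 2 * G.yInvariant p := by
      have hP : ∀ x, ∑ e, (G.voltage p (G.src e) x - G.voltage p (G.tgt e) x) ^ 2 / G.len e =
          G.voltage p x x := fun x => by
        have h := sum_sq_voltage_sub hG p x p
        simp only [voltage_base hG, sub_zero] at h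
        change _ = G.voltage p x x at h
        simpa only [voltage_symm hG p x] using h
      simp only [sum_div]
      rw [sum_comm, yInvariant_eq_sum_voltage hG, mul_sum]
      refine sum_congr rfl fun f _ => ?_
      have hT : ∑ e, ((G.voltage p (G.src e) (G.src f) - G.voltage p (G.src e) (G.tgt f)) -
            (G.voltage p (G.tgt e) (G.src f) - G.voltage p (G.tgt e) (G.tgt f))) ^ 2 / G.len e =
          G.resistance (G.src f) (G.tgt f) := by
        rw [← sum_sq_voltage_sub hG p (G.src f) (G.tgt f)]
        refine sum_congr rfl fun e _ => ?_
        simp only [voltage_symm hG p (G.src f), voltage_symm hG p (G.tgt f)]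
        ring
      trans (1 / 2 * G.resistance (G.src f) (G.tgt f) *
          (∑ e, ((G.voltage p (G.src e) (G.src f) - G.voltage p (G.src e) (G.tgt f)) -
            (G.voltage p (G.tgt e) (G.src f) - G.voltage p (G.tgt e) (G.tgt f))) ^ 2 / G.len e) +
        3 / 2 * (G.voltage p (G.src f) (G.src f) - G.voltage p (G.tgt f) (G.tgt f)) *
          (∑ e, (G.voltage p (G.src e) (G.src f) - G.voltage p (G.tgt e) (G.src f)) ^ 2 /
              G.len e -
            ∑ e, (G.voltage p (G.src e) (G.tgt f) - G.voltage p (G.tgt e) (G.tgt f)) ^ 2 /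
              G.len e)) / G.len f
      · rw [← sum_sub_distrib, mul_sum, mul_sum, ← sum_add_distrib, sum_div]
        exact sum_congr rfl fun e _ => by ring
      · rw [hT, hP, hP, resistance_eq_voltage hG p]
        ring
    have h3 : ∑ e, (1 / 4 * G.resistance (G.src e) (G.tgt e) ^ 2 + 3 / 4 *
        (G.voltage p (G.src e) (G.src e) - G.voltage p (G.tgt e) (G.tgt e)) ^ 2) / G.len e =
        G.yInvariant p := by
      rw [yInvariant_eq_sum_voltage hG]
      exact sum_congr rfl fun e _ => by rw [resistance_eq_voltage hG p]
    rw [sum_congr rfl fun e _ => add_div _ _ _, sum_add_distrib,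
      sum_congr rfl fun e _ => sub_div _ _ _, sum_sub_distrib, h1, h2, h3]
    ring
  · intro e he
    simp [he, resistance_self hG]

/-- Foster minus Thomson gives (v - 2) Kf for the full double sum; the row of the merged vertex
removes 2 Kf - v y. -/
theorem sum_weight_mul_kirchhoffIndex_contract [DecidablePred fun e : G.E => G.src e ≠ G.tgt e]
    (p : G.V) :
    ∑ e : G.E with G.src e ≠ G.tgt e, G.weight e * (G.contract e).kirchhoffIndex =
      (Fintype.card G.V - 4) * G.kirchhoffIndex + Fintype.card G.V * G.yInvariant p := by
  rw [sum_weight_mul_eq hG _ _ (fun e he => kirchhoffIndex_contract he hG p)]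
  · have h1 : ∑ e, (∑ x, ∑ y, (G.resistance (G.src e) (G.tgt e) * G.resistance x y -
        ((G.voltage p x (G.src e) - G.voltage p x (G.tgt e)) -
          (G.voltage p y (G.src e) - G.voltage p y (G.tgt e))) ^ 2)) / G.len e =
        (Fintype.card G.V - 2) * ∑ x, ∑ y, G.resistance x y := by
      simp only [sum_div, mul_sum]
      rw [sum_comm]
      refine sum_congr rfl fun x _ => ?_
      rw [sum_comm]
      refine sum_congr rfl fun y _ => ?_
      simp only [sub_div, sum_sub_distrib]
      rw [sum_sq_voltage_sub hG p, sum_congr rfl fun e _ => mul_div_right_comm _ _ _, ← sum_mul,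
        sum_resistance_div_len hG]
      ring
    have h2 : ∀ y, ∑ e, (G.resistance (G.src e) (G.tgt e) * G.resistance (G.src e) y -
        (G.resistance (G.src e) (G.tgt e) + G.resistance (G.src e) y -
          G.resistance (G.tgt e) y) ^ 2 / 4) / G.len e =
        ∑ x, G.resistance x y - G.yInvariant p := fun y => by
      have h := sum_edge_voltage hG y (fun x => G.resistance x y)
      rw [resistance_self hG, sub_zero] at h
      rw [yInvariant_base_indep hG p y, yInvariant_eq_sum_voltage hG, ← h, ← sum_sub_distrib]
      refine sum_congr rfl fun e _ => ?_
      rw [resistance_eq_voltage hG y (G.src e) (G.tgt e)]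
      simp only [resistance]
      ring
    have h3 : ∑ e, (∑ y, (G.resistance (G.src e) (G.tgt e) * G.resistance (G.src e) y -
        (G.resistance (G.src e) (G.tgt e) + G.resistance (G.src e) y -
          G.resistance (G.tgt e) y) ^ 2 / 4)) / G.len e =
        ∑ x, ∑ y, G.resistance x y - Fintype.card G.V * G.yInvariant p := by
      simp only [sum_div]
      rw [sum_comm, sum_congr rfl fun y _ => h2 y, sum_sub_distrib, sum_comm]
      simp
    simp only [sub_div, mul_div_assoc]
    rw [sum_sub_distrib, ← mul_sum, h1, h3, kirchhoffIndex]
    ring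
  · intro e he
    simp [he, resistance_self hG]

/-- The iterated contraction sum of the Kirchhoff index, on a graph with `n + k + 4` vertices. -/
theorem contractionSum_kirchhoffIndex (k n : ℕ) (hn : Fintype.card G.V = n + k + 4) (p : G.V) :
    contractionSum kirchhoffIndex k G * n.factorial = (n + k).factorial *
      (G.kirchhoffIndex + ((((n : ℝ) + k + 4) ^ 2 - (k + 2) * (n + k + 4) + k - 1) * k) /
        ((n + 2) * (n + 1)) * G.yInvariant p) := by
  classical
  -- A contraction lowers both the number of vertices and the number of remaining steps by one, so
  -- `n` stays fixed.
  induction k generalizing G with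
  | zero => simp [contractionSum, mul_comm]
  | succ k ih =>
    have hstep : ∀ e ∈ (univ.filter fun e : G.E => G.src e ≠ G.tgt e),
        G.weight e * contractionSum kirchhoffIndex k (G.contract e) * n.factorial =
          (n + k).factorial * (G.weight e * (G.contract e).kirchhoffIndex) + (n + k).factorial *
            (((((n : ℝ) + k + 4) ^ 2 - (k + 2) * (n + k + 4) + k - 1) * k) /
              ((n + 2) * (n + 1))) *
                (G.weight e * (G.contract e).yInvariant (G.contractMk e p)) := by
      intro e he
      have hc : Fintype.card (G.contract e).V = n + k + 4 := by
        have := card_contract (mem_filter.1 he).2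
        rw [hn] at this
        push_cast at this
        have : (Fintype.card (G.contract e).V : ℝ) = ((n + k + 4 : ℕ) : ℝ) := by
          push_cast; linarith
        exact_mod_cast this
      rw [mul_assoc, ih (connected_contract e hG) hc (G.contractMk e p)]
      ring
    have hA := sum_weight_mul_kirchhoffIndex_contract hG p
    have hB := sum_weight_mul_yInvariant_contract hG p
    rw [hn] at hA hB
    have hs : contractionSum kirchhoffIndex (k + 1) G = ∑ e : G.E with G.src e ≠ G.tgt e,
      G.weight e * contractionSum kirchhoffIndex k (G.contract e) := by
      rw [contractionSum]
    rw [hs, sum_mul, sum_congr rfl hstep, sum_add_distrib, ← mul_sum, ← mul_sum, hA, hB,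
      ← add_assoc n k 1, Nat.factorial_succ]
    push_cast
    field_simp
    ring

end Recursion

end LengthGraph

/-! ### The formula in terms of v and k. -/

theorem mainTheorem2 (Γ : LengthGraph.{u, w}) (hΓ : Γ.Connected) (p : Γ.V)
    (v : ℕ) (hv : Fintype.card Γ.V = v) (hv5 : 5 ≤ v) :
    (∀ k : ℕ, 1 ≤ k → k ≤ v - 4 →
      Γ.kirchhoffIndex =
        (Nat.factorial (v - 4 - k) : ℝ) / (Nat.factorial (v - 4) : ℝ) *
            LengthGraph.contractionSum LengthGraph.kirchhoffIndex k Γ -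
          (((v : ℝ) ^ 2 - ((k : ℝ) + 2) * v + k - 1) * k) /
              (((v : ℝ) - k - 2) * ((v : ℝ) - k - 3)) * Γ.yInvariant p) ∧
    Γ.kirchhoffIndex =
      1 / (Nat.factorial (v - 4) : ℝ) *
          LengthGraph.contractionSum LengthGraph.kirchhoffIndex (v - 4) Γ -
        (3 * (v : ℝ) - 5) * ((v : ℝ) - 4) / 2 * Γ.yInvariant p := by
  have key : ∀ k : ℕ, k ≤ v - 4 →
      Γ.kirchhoffIndex =
        (Nat.factorial (v - 4 - k) : ℝ) / (Nat.factorial (v - 4) : ℝ) *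
            LengthGraph.contractionSum LengthGraph.kirchhoffIndex k Γ -
          (((v : ℝ) ^ 2 - ((k : ℝ) + 2) * v + k - 1) * k) /
              (((v : ℝ) - k - 2) * ((v : ℝ) - k - 3)) * Γ.yInvariant p := by
    intro k hk
    obtain ⟨n, rfl⟩ : ∃ n, v = n + k + 4 := ⟨v - 4 - k, by omega⟩
    have h := LengthGraph.contractionSum_kirchhoffIndex hΓ k n hv p
    have hn : n + k + 4 - 4 - k = n := by omega
    have hnk : n + k + 4 - 4 = n + k := by omega
    have hf : ((n + k).factorial : ℝ) ≠ 0 := by positivity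
    rw [hn, hnk, div_mul_eq_mul_div, mul_comm (n.factorial : ℝ), h, mul_div_cancel_left₀ _ hf]
    push_cast
    have h2 : (n : ℝ) + k + 4 - k - 2 = n + 2 := by ring
    have h3 : (n : ℝ) + k + 4 - k - 3 = n + 1 := by ring
    rw [h2, h3]
    ring
  -- The case k = v - 4 has n = 0, so the denominator (n + 2)(n + 1) is 2.
  refine ⟨fun k _ => key k, ?_⟩
  have h := key (v - 4) le_rfl
  rw [Nat.sub_self, Nat.factorial_zero, Nat.cast_one, Nat.cast_sub (by omega : 4 ≤ v)] at h
  refine h.trans ?_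
  push_cast
  have h2 : (v : ℝ) - (v - 4) - 2 = 2 := by ring
  have h3 : (v : ℝ) - (v - 4) - 3 = 1 := by ring
  rw [h2, h3]
  ring
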